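/- There are absolute constants $c, C > 0$ such that the following holds. Let $G = (V,E)$ be an arbitrary finite simple undirected graph with $n$ vertices, and let $k > 0$ be a real number with $k \ge c \log n$. Let $G' = (V,S)$ be a random expected $k$-out subgraph of $G$: each vertex $v$ samples each one of its incident edges with probability $k/\max\{k, \deg(v)\}$, all these choices (over all vertices and all their incident edges) being independent, and $S \subseteq E$ is the set of the edges that were sampled by at least one of their endpoints. Then the expected number of edges of $G$ that connect different connected components of $G'$ is at most $C \cdot n/k$. -/

import Mathlib

open MeasureTheory

noncomputable section

/-- The probability `k / max {k, deg v}` with which the vertex `v` samples each one of its incident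
edges in the expected `k`-out model, as an element of the unit interval. -/
def sampleProb {V : Type*} [Fintype V] (G : SimpleGraph V) [DecidableRel G.Adj]
    (k : NNReal) (v : V) : unitInterval :=
  ⟨(k : ℝ) / max (k : ℝ) (G.degree v : ℝ),
    div_nonneg k.coe_nonneg (le_max_of_le_left k.coe_nonneg),
    div_le_one_of_le₀ (le_max_left _ _) (le_max_of_le_left k.coe_nonneg)⟩

/-- The law of the choices in the expected `k`-out model. A dart `d` of `G` is an edge together with
one of its endpoints `d.fst`; `ω d = true` means that the vertex `d.fst` samples the edge `d.edge`.
All these choices are independent, and each is `true` with probability `k / max {k, deg d.fst}`. -/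
def expectedKOutLaw {V : Type*} [Fintype V] (G : SimpleGraph V) [DecidableRel G.Adj]
    (k : NNReal) : Measure (G.Dart → Bool) :=
  Measure.pi fun d => ProbabilityTheory.bernoulliMeasure true false (sampleProb G k d.fst)

/-- The subgraph `G' = (V, S)`, where `S` is the set of the edges of `G` that were sampled by at
least one of their endpoints. -/
def sampledSubgraph {V : Type*} (G : SimpleGraph V) (ω : G.Dart → Bool) : SimpleGraph V :=
  SimpleGraph.fromEdgeSet {e | ∃ d : G.Dart, d.edge = e ∧ ω d = true}

/-- The edges of `G` that connect different connected components of `H`. -/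
def interComponentEdges {V : Type*} (G H : SimpleGraph V) : Set (Sym2 V) :=
  {e | ∃ u v : V, e = s(u, v) ∧ G.Adj u v ∧
    H.connectedComponentMk u ≠ H.connectedComponentMk v}

/-- The expected number of edges of `G` that connect different connected components of a random
expected `k`-out subgraph of `G`. (The expectation of a function on a finite probability space.) -/
def expectedInterComponentEdges {V : Type*} [Fintype V] (G : SimpleGraph V) [DecidableRel G.Adj]
    (k : NNReal) : ℝ :=
  ∫ ω, ((interComponentEdges G (sampledSubgraph G ω)).ncard : ℝ) ∂(expectedKOutLaw G k)

end

/-!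
Every choice probability `p` is split into two independent rounds, with probabilities `p / 2` and
`p / (2 - p)`; an edge is sampled when it is sampled in at least one of the rounds (`boolExp_or`).

*First round.* With probability `1 - O(n ^ 2 * exp (-k / 64))`, every vertex `v` of degree greater
than `k` lies in a component with at least `deg v / 72` vertices (`boolExp_exists_not_good_le`).
Suppose this fails, let `v` be a failing vertex of least degree `d`, and look at its component,
which has fewer than `d / 72` vertices. One of two things happens (`exists_stuck`).

* Some vertex `x` of the component has degree at least `d`, and at least half of its neighbours have
  degree less than `d`. These neighbours are not failing, so those outside the component of `x` lie
  in large components, which remain the same when the edges at `x` are deleted, hence are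
  independent of the choices made by the neighbours of `x` on their edges to `x`. Exposing these
  choices one at a time, an exponential potential shows that the clusters attached to `x` have
  `d / 72` vertices in total, except with probability `exp (-k / 64)` (`boolExp_growth_le`).
* Otherwise the vertices of degree at least `d` in the component form a nonempty set `T`, each
  element of which has at least a quarter of its neighbours among the vertices of degree at least
  `d` outside `T` and chooses none of them. For fixed `T` this has probability at most
  `exp (-k / 8) ^ #T` (`boolExp_stuckIn_le`), which is small enough for a union bound over all `T`.

*Second round.* Let `f v` be the degree of `v` if it exceeds `k` and `0` otherwise, and consider the
sum over the components of the largest value of `f`. After a successful first round it is at most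
`72 n`. Expose the edges one at a time: an edge `uv` between two components that is sampled lowers
this sum by at least `min (f u) (f v)` (`leaderSum_add_le`), while the odds that it is missed are at
most `2 min (f u) (f v) / k`. Hence at most `144 n / k` edges between components are expected to be
missed (`boolExp_interComponentEdges_le`). Since `k ≥ 400 log n`, an unsuccessful first round
contributes at most `n ^ 2 * 3 n ^ 2 * exp (-k / 64) ≤ 384 n / k`.
-/

noncomputable section

/-! ### Expectations over independent Boolean choices -/

/-- The expectation of `f` when the coordinates of `ω : ι → Bool` are independent and `ω i` is
`true` with probability `p i`, written as a finite weighted sum. -/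
def boolExp {ι : Type*} [Fintype ι] [DecidableEq ι] (p : ι → ℝ) (f : (ι → Bool) → ℝ) : ℝ :=
  ∑ ω, (∏ i, if ω i then p i else 1 - p i) * f ω

/-- The average of `f` over the coordinate `i` alone, the other coordinates being kept. -/
def coordAvg {ι : Type*} [DecidableEq ι] (p : ι → ℝ) (i : ι) (f : (ι → Bool) → ℝ)
    (ω : ι → Bool) : ℝ :=
  p i * f (Function.update ω i true) + (1 - p i) * f (Function.update ω i false)

section BoolExp

variable {ι : Type*} [Fintype ι] [DecidableEq ι] {p : ι → ℝ}

theorem sum_prod_bool (h : ι → Bool → ℝ) :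
    ∑ ω : ι → Bool, ∏ i, h i (ω i) = ∏ i, (h i true + h i false) := by
  have := Finset.prod_univ_sum (fun _ : ι => (Finset.univ : Finset Bool)) h
  rw [Fintype.piFinset_univ] at this
  simpa using this.symm

omit [DecidableEq ι] in
theorem boolWeight_nonneg (hp : ∀ i, 0 ≤ p i ∧ p i ≤ 1) (ω : ι → Bool) :
    0 ≤ ∏ i, (if ω i then p i else 1 - p i) := by
  refine Finset.prod_nonneg fun i _ => ?_
  split_ifs
  · exact (hp i).1
  · linarith [(hp i).2]

theorem boolExp_mono (hp : ∀ i, 0 ≤ p i ∧ p i ≤ 1) {f g : (ι → Bool) → ℝ} (h : ∀ ω, f ω ≤ g ω) :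
    boolExp p f ≤ boolExp p g :=
  Finset.sum_le_sum fun ω _ => mul_le_mul_of_nonneg_left (h ω) (boolWeight_nonneg hp ω)

theorem boolExp_const (c : ℝ) : boolExp p (fun _ => c) = c := by
  have h := sum_prod_bool (fun i (b : Bool) => if b then p i else 1 - p i)
  simp only [if_true, Bool.false_eq_true, if_false, add_sub_cancel, Finset.prod_const_one] at h
  rw [boolExp, ← Finset.sum_mul, h, one_mul]

theorem boolExp_add (f g : (ι → Bool) → ℝ) :
    boolExp p (fun ω => f ω + g ω) = boolExp p f + boolExp p g := by
  simp only [boolExp, mul_add, Finset.sum_add_distrib]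

theorem boolExp_const_mul (c : ℝ) (f : (ι → Bool) → ℝ) :
    boolExp p (fun ω => c * f ω) = c * boolExp p f := by
  simp only [boolExp, Finset.mul_sum]
  exact Finset.sum_congr rfl fun ω _ => by ring

theorem boolExp_sum {α : Type*} (s : Finset α) (f : α → (ι → Bool) → ℝ) :
    boolExp p (fun ω => ∑ a ∈ s, f a ω) = ∑ a ∈ s, boolExp p (f a) := by
  simp only [boolExp, Finset.mul_sum]
  exact Finset.sum_comm

/-- Resampling one coordinate does not change the expectation. -/
theorem boolExp_coordAvg (i : ι) (f : (ι → Bool) → ℝ) :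
    boolExp p (coordAvg p i f) = boolExp p f := by
  -- Pair each `ω` with the `ω` that differs from it at `i` alone.
  set σ : (ι → Bool) → (ι → Bool) := fun ω => Function.update ω i (!(ω i)) with hσ
  have hinv : Function.Involutive σ := fun ω => by
    simp [hσ]
  have hpair : ∀ g : (ι → Bool) → ℝ, 2 * ∑ ω, g ω = ∑ ω, (g ω + g (σ ω)) := fun g => by
    rw [Finset.sum_add_distrib, two_mul, hinv.bijective.sum_comp g]
  have hw : ∀ (ω : ι → Bool) (b : Bool),
      (∏ j, if Function.update ω i b j then p j else 1 - p j) =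
        (if b then p i else 1 - p i) *
          ∏ j ∈ Finset.univ.erase i, (if ω j then p j else 1 - p j) := by
    intro ω b
    rw [← Finset.mul_prod_erase _ _ (Finset.mem_univ i)]
    congr 1
    · simp
    · refine Finset.prod_congr rfl fun j hj => ?_
      rw [Function.update_of_ne (Finset.ne_of_mem_erase hj)]
  have key : ∀ (g : (ι → Bool) → ℝ) (ω : ι → Bool),
      (∏ j, if ω j then p j else 1 - p j) * g ω + (∏ j, if σ ω j then p j else 1 - p j) * g (σ ω) =
        (∏ j ∈ Finset.univ.erase i, (if ω j then p j else 1 - p j)) * coordAvg p i g ω := by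
    intro g ω
    have h1 := hw ω (ω i)
    rw [Function.update_eq_self] at h1
    rw [h1, hσ]
    simp only [hw, coordAvg]
    cases hb : ω i
    · have h2 : Function.update ω i false = ω := by rw [← hb, Function.update_eq_self]
      simp [h2]; ring
    · have h2 : Function.update ω i true = ω := by rw [← hb, Function.update_eq_self]
      simp [h2]; ring
  have havg : ∀ ω, coordAvg p i (coordAvg p i f) ω = coordAvg p i f ω := fun ω => by
    simp only [coordAvg, Function.update_idem]; ring
  have : 2 * boolExp p (coordAvg p i f) = 2 * boolExp p f := by
    simp only [boolExp, hpair, key, havg]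
  linarith

/-- Sequential exposure: a potential that does not increase on average when the coordinates
`d a`, `a ∈ A`, are exposed one at a time does not increase in expectation. -/
theorem boolExp_potential_le (hp : ∀ i, 0 ≤ p i ∧ p i ≤ 1) {α : Type*} [DecidableEq α]
    (d : α → ι) (Z : Finset α → (ι → Bool) → ℝ) (A : Finset α)
    (hZ : ∀ L a, a ∈ A → a ∉ L → ∀ ω, coordAvg p (d a) (Z (insert a L)) ω ≤ Z L ω) :
    boolExp p (Z A) ≤ boolExp p (Z ∅) := by
  suffices h : ∀ B, B ⊆ A → boolExp p (Z B) ≤ boolExp p (Z ∅) from h A subset_rfl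
  intro B
  induction B using Finset.induction_on with
  | empty => exact fun _ => le_rfl
  | insert a L ha ih =>
    intro hL
    rw [← boolExp_coordAvg (d a)]
    exact (boolExp_mono hp (hZ L a (hL (Finset.mem_insert_self a L)) ha)).trans
      (ih ((Finset.subset_insert a L).trans hL))

/-- The probability that no coordinate in `I` is `true`. -/
theorem boolExp_forall_false (I : Finset ι) :
    boolExp p (fun ω => if ∀ i ∈ I, ω i = false then 1 else 0) = ∏ i ∈ I, (1 - p i) := by
  have h := sum_prod_bool (fun i (b : Bool) =>
    (if b then p i else 1 - p i) * if i ∈ I → b = false then 1 else 0)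
  rw [boolExp]
  have h2 : ∀ ω : ι → Bool, (if ∀ i ∈ I, ω i = false then (1 : ℝ) else 0) =
      ∏ i, if i ∈ I → ω i = false then (1 : ℝ) else 0 := by
    intro ω
    rw [Finset.prod_ite_zero]
    simp
  simp only [h2, ← Finset.prod_mul_distrib]
  rw [h, ← Finset.prod_subset (Finset.subset_univ I)]
  · exact Finset.prod_congr rfl fun i hi => by simp [hi]
  · intro i _ hi
    simp [hi]

/-- The coordinatewise disjunction of two independent rounds, with success probabilities `a` and
`b`, is one round with failure probabilities `(1 - a) (1 - b)`. -/
theorem boolExp_or {a b : ι → ℝ} (h : ∀ i, 1 - p i = (1 - a i) * (1 - b i))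
    (f : (ι → Bool) → ℝ) :
    boolExp p f = boolExp a fun ω₁ => boolExp b fun ω₂ => f fun i => ω₁ i || ω₂ i := by
  have hpw : ∀ ω : ι → Bool, (∏ i, if ω i then p i else 1 - p i) =
      ∑ ω₁ : ι → Bool, ∑ ω₂ : ι → Bool,
        (if (fun i => ω₁ i || ω₂ i) = ω then
          (∏ i, if ω₁ i then a i else 1 - a i) * (∏ i, if ω₂ i then b i else 1 - b i) else 0) := by
    intro ω
    have h1 := Finset.prod_univ_sum (fun _ : ι => (Finset.univ : Finset (Bool × Bool)))
      (fun i c => if (c.1 || c.2) = ω i then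
        (if c.1 then a i else 1 - a i) * (if c.2 then b i else 1 - b i) else 0)
    rw [Fintype.piFinset_univ] at h1
    rw [← Fintype.sum_prod_type',
      ← (Equiv.arrowProdEquivProdArrow ι (fun _ => Bool) (fun _ => Bool)).sum_comp]
    trans ∏ i, ∑ c : Bool × Bool, (if (c.1 || c.2) = ω i then
        (if c.1 then a i else 1 - a i) * (if c.2 then b i else 1 - b i) else 0)
    · refine Finset.prod_congr rfl fun i _ => ?_
      have := h i
      cases ω i <;> simp [Fintype.sum_prod_type] <;> linarith
    · rw [h1]
      refine Finset.sum_congr rfl fun x _ => ?_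
      rw [Finset.prod_ite_zero, Finset.prod_mul_distrib]
      simp only [Equiv.arrowProdEquivProdArrow, Equiv.coe_fn_mk, funext_iff, Finset.mem_univ,
        forall_const]
      congr
  simp only [boolExp, hpw, Finset.sum_mul, Finset.mul_sum]
  rw [Finset.sum_comm]
  refine Finset.sum_congr rfl fun ω₁ _ => ?_
  rw [Finset.sum_comm]
  refine Finset.sum_congr rfl fun ω₂ _ => ?_
  simp only [ite_mul, zero_mul]
  rw [Finset.sum_ite_eq]
  simp [mul_assoc]

end BoolExp

open scoped Classical in
theorem expectedInterComponentEdges_eq_boolExp {V : Type*} [Fintype V] (G : SimpleGraph V)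
    [DecidableRel G.Adj] (k : NNReal) :
    expectedInterComponentEdges G k =
      boolExp (fun d : G.Dart => (k : ℝ) / max (k : ℝ) (G.degree d.fst : ℝ)) fun ω =>
        ((interComponentEdges G (sampledSubgraph G ω)).ncard : ℝ) := by
  have : IsProbabilityMeasure (expectedKOutLaw G k) := by
    unfold expectedKOutLaw; infer_instance
  rw [expectedInterComponentEdges, integral_fintype (Integrable.of_finite), boolExp]
  refine Finset.sum_congr rfl fun ω _ => ?_
  rw [smul_eq_mul]
  congr 1
  rw [expectedKOutLaw, measureReal_def, Measure.pi_singleton, ENNReal.toReal_prod]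
  refine Finset.prod_congr rfl fun d _ => ?_
  rw [← measureReal_def, ProbabilityTheory.bernoulliMeasure_real_apply _
    (measurableSet_singleton _)]
  cases ω d <;> simp [sampleProb]

/-! ### A potential on graphs that pays for merging components -/

section Potential

variable {V R : Type*} [Fintype V] [LinearOrder R]

open scoped Classical in
/-- The vertex set of the connected component of `v` in `H`. -/
def compFinset (H : SimpleGraph V) (v : V) : Finset V := {u | H.Reachable v u}

@[simp]
theorem mem_compFinset {H : SimpleGraph V} {v u : V} : u ∈ compFinset H v ↔ H.Reachable v u := by
  simp [compFinset]

open scoped Classical in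
/-- The leaders of `H` for the ranking `ρ`: the vertices of largest rank in their component. -/
def leaders (ρ : V → R) (H : SimpleGraph V) : Finset V :=
  {v | ∀ u, H.Reachable v u → ρ u ≤ ρ v}

theorem mem_leaders {ρ : V → R} {H : SimpleGraph V} {v : V} :
    v ∈ leaders ρ H ↔ ∀ u, H.Reachable v u → ρ u ≤ ρ v := by
  simp [leaders]

theorem leaders_anti (ρ : V → R) {H H' : SimpleGraph V} (h : H ≤ H') :
    leaders ρ H' ⊆ leaders ρ H := fun _ hv =>
  mem_leaders.2 fun u hu => mem_leaders.1 hv u (hu.mono h)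

theorem exists_leader (ρ : V → R) (H : SimpleGraph V) (v : V) :
    ∃ l ∈ leaders ρ H, H.Reachable v l ∧ ρ v ≤ ρ l := by
  obtain ⟨l, hl, hmax⟩ := (compFinset H v).exists_max_image ρ ⟨v, by simp⟩
  rw [mem_compFinset] at hl
  exact ⟨l, mem_leaders.2 fun u hu => hmax u (by simpa using hl.trans hu), hl, hmax v (by simp)⟩

/-- The sum of `f` over the leaders of `H`. When `ρ` refines the order of the values of `f`, this
is the sum over the components of `H` of the largest value of `f` in the component. -/
def leaderSum (ρ : V → R) (f : V → ℝ) (H : SimpleGraph V) : ℝ := ∑ v ∈ leaders ρ H, f v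

theorem leaderSum_nonneg (ρ : V → R) {f : V → ℝ} (hf : ∀ v, 0 ≤ f v) (H : SimpleGraph V) :
    0 ≤ leaderSum ρ f H := Finset.sum_nonneg fun v _ => hf v

theorem leaderSum_anti (ρ : V → R) {f : V → ℝ} (hf : ∀ v, 0 ≤ f v) {H H' : SimpleGraph V}
    (h : H ≤ H') : leaderSum ρ f H' ≤ leaderSum ρ f H :=
  Finset.sum_le_sum_of_subset_of_nonneg (leaders_anti ρ h) fun v _ _ => hf v

/-- Merging the components of `u` and `v` costs the potential at least the smaller of `f u` and
`f v`, since the leader of one of the two components is lost. -/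
theorem leaderSum_add_le {ρ : V → R} (hρ : Function.Injective ρ) {f : V → ℝ} (hf : ∀ v, 0 ≤ f v)
    (hρf : ∀ u v, ρ u ≤ ρ v → f u ≤ f v) {H H' : SimpleGraph V} (h : H ≤ H') {u v : V}
    (huv : ¬ H.Reachable u v) (huv' : H'.Reachable u v) (hfuv : f u ≤ f v) :
    leaderSum ρ f H' + f u ≤ leaderSum ρ f H := by
  classical
  obtain ⟨l₁, hl₁, hr₁, hle₁⟩ := exists_leader ρ H u
  obtain ⟨l₂, hl₂, hr₂, hle₂⟩ := exists_leader ρ H v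
  have hr : H'.Reachable l₁ l₂ := (hr₁.mono h).symm.trans (huv'.trans (hr₂.mono h))
  have hne : ρ l₁ ≠ ρ l₂ := fun e => huv (hr₁.trans (hρ e ▸ hr₂.symm))
  obtain ⟨l, hl, hlost, hfl⟩ : ∃ l ∈ leaders ρ H, l ∉ leaders ρ H' ∧ f u ≤ f l := by
    rcases lt_or_gt_of_ne hne with hlt | hlt
    · exact ⟨l₁, hl₁, fun hc => (mem_leaders.1 hc l₂ hr).not_gt hlt, hρf _ _ hle₁⟩
    · exact ⟨l₂, hl₂, fun hc => (mem_leaders.1 hc l₁ hr.symm).not_gt hlt,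
        hfuv.trans (hρf _ _ hle₂)⟩
  have hsub : insert l (leaders ρ H') ⊆ leaders ρ H :=
    Finset.insert_subset hl (leaders_anti ρ h)
  have := Finset.sum_le_sum_of_subset_of_nonneg (f := f) hsub fun v _ _ => hf v
  rw [Finset.sum_insert hlost] at this
  unfold leaderSum
  linarith

theorem leaderSum_le_card {ρ : V → R} (hρ : Function.Injective ρ) {f : V → ℝ} {K : ℝ} (hK : 0 ≤ K)
    {H : SimpleGraph V} (hf : ∀ v, f v ≤ K * (compFinset H v).card) :
    leaderSum ρ f H ≤ K * Fintype.card V := by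
  classical
  have hdisj : ((leaders ρ H : Finset V) : Set V).PairwiseDisjoint (compFinset H) := by
    intro l hl l' hl' hne
    refine Finset.disjoint_left.2 fun w hw hw' => hne (hρ ?_)
    rw [mem_compFinset] at hw hw'
    have hr := hw.trans hw'.symm
    exact le_antisymm (mem_leaders.1 hl' l hr.symm) (mem_leaders.1 hl l' hr)
  calc leaderSum ρ f H ≤ ∑ v ∈ leaders ρ H, K * ((compFinset H v).card : ℝ) :=
        Finset.sum_le_sum fun v _ => hf v
    _ = K * (((leaders ρ H).biUnion (compFinset H)).card : ℝ) := by
        rw [← Finset.mul_sum, Finset.card_biUnion hdisj, Nat.cast_sum]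
    _ ≤ K * Fintype.card V := by
        gcongr
        exact Finset.card_le_univ _

theorem exists_ranking (f : V → ℝ) :
    ∃ ρ : V → ℝ ×ₗ Fin (Fintype.card V), Function.Injective ρ ∧ ∀ u v, ρ u ≤ ρ v → f u ≤ f v := by
  refine ⟨fun v => toLex (f v, Fintype.equivFin V v), fun u v h => ?_, fun u v h => ?_⟩
  · simpa using congrArg (fun x => (ofLex x).2) h
  · exact Prod.Lex.monotone_fst _ _ h

end Potential

/-! ### Sampling edges on top of a graph with large components -/

section Sampling

variable {V R : Type*} [Fintype V] [LinearOrder R]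

/-- The graph `H` together with the edges of the darts in `L` that `ω` selects. -/
def addDarts {G : SimpleGraph V} (H : SimpleGraph V) (L : Finset G.Dart) (ω : G.Dart → Bool) :
    SimpleGraph V :=
  H ⊔ SimpleGraph.fromEdgeSet {e | ∃ d ∈ L, d.edge = e ∧ ω d = true}

open scoped Classical in
/-- If unsampled edges are charged to the potential of the components that a sampled edge would
merge, then the expected number of edges left between components is at most the potential of the
initial graph. -/
theorem boolExp_interComponentEdges_le {G : SimpleGraph V} [DecidableRel G.Adj]
    [DecidableEq G.Dart]
    {ρ : V → R} (hρ : Function.Injective ρ) {f : V → ℝ} (hf : ∀ v, 0 ≤ f v)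
    (hρf : ∀ u v, ρ u ≤ ρ v → f u ≤ f v) {b : G.Dart → ℝ} (hb : ∀ d, 0 ≤ b d ∧ b d ≤ 1)
    {c : ℝ} (hc : 0 ≤ c) (hbc : ∀ d, 1 - b d ≤ b d * (c * f d.fst)) (H : SimpleGraph V) :
    boolExp b (fun ω => ((interComponentEdges G (H ⊔ sampledSubgraph G ω)).ncard : ℝ)) ≤
      c * leaderSum ρ f H := by
  -- Each edge is represented by a dart that starts at an endpoint with the smaller value of `f`.
  set D : Finset G.Dart := {d | f d.fst ≤ f d.snd} with hD
  let cnt : Finset G.Dart → SimpleGraph V → ℝ := fun L F =>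
    ((L.filter fun d => ¬ F.Reachable d.fst d.snd).card : ℝ)
  -- `Z L` counts the darts of `L` left between components, plus what the potential still allows.
  let Z : Finset G.Dart → (G.Dart → Bool) → ℝ := fun L ω =>
    cnt L (addDarts H L ω) + c * leaderSum ρ f (addDarts H L ω)
  have hcnt_anti : ∀ L {F F' : SimpleGraph V}, F ≤ F' → cnt L F' ≤ cnt L F := by
    intro L F F' h
    simp only [cnt, Nat.cast_le]
    exact Finset.card_le_card (Finset.monotone_filter_right L fun d _ hd hd' => hd (hd'.mono h))
  have hstep := boolExp_potential_le hb id Z D (by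
    intro L d hd hdL ω
    have hfd : f d.fst ≤ f d.snd := by simpa [hD] using hd
    have hcongr : ∀ b', ∀ d' ∈ L, Function.update ω d b' d' = ω d' := fun b' d' hd' =>
      Function.update_of_ne (fun e => hdL (by rwa [← e])) _ _
    have hF : addDarts H (insert d L) (Function.update ω d false) = addDarts H L ω := by
      unfold addDarts
      congr 2
      ext e
      simp only [Finset.mem_insert, Set.mem_ofPred_eq]
      constructor
      · rintro ⟨d', rfl | hd', rfl, h2⟩
        · simp at h2
        · exact ⟨d', hd', rfl, by rwa [hcongr _ _ hd'] at h2⟩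
      · rintro ⟨d', hd', rfl, h2⟩
        exact ⟨d', Or.inr hd', rfl, by rwa [hcongr _ _ hd']⟩
    have hT : addDarts H L ω ≤ addDarts H (insert d L) (Function.update ω d true) := by
      refine sup_le_sup le_rfl (SimpleGraph.fromEdgeSet_mono ?_)
      rintro _ ⟨d', hd', rfl, h2⟩
      exact ⟨d', Finset.mem_insert_of_mem hd', rfl, by rwa [hcongr _ _ hd']⟩
    have hTd : (addDarts H (insert d L) (Function.update ω d true)).Reachable d.fst d.snd := by
      refine SimpleGraph.Adj.reachable (Or.inr ?_)
      rw [SimpleGraph.fromEdgeSet_adj]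
      exact ⟨⟨d, Finset.mem_insert_self _ _, rfl, by simp⟩, d.adj.ne⟩
    simp only [coordAvg, id, Z, hF]
    generalize addDarts H (insert d L) (Function.update ω d true) = T at hT hTd ⊢
    generalize addDarts H L ω = F at hT ⊢
    have hcT : cnt (insert d L) T ≤ cnt L F := by
      refine le_trans (le_of_eq ?_) (hcnt_anti L hT)
      simp only [cnt]
      rw [Finset.filter_insert, if_neg (by simpa using hTd)]
    have hΨ := leaderSum_anti ρ hf hT
    have hb1 := (hb d).1
    have hb2 := (hb d).2
    by_cases hr : F.Reachable d.fst d.snd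
    · have hcF : cnt (insert d L) F = cnt L F := by
        simp only [cnt]
        rw [Finset.filter_insert, if_neg (by simpa using hr)]
      rw [hcF]
      have h1 : b d * (cnt (insert d L) T + c * leaderSum ρ f T) ≤
          b d * (cnt L F + c * leaderSum ρ f F) := by gcongr
      linarith
    · have hcF : cnt (insert d L) F = cnt L F + 1 := by
        simp only [cnt]
        rw [Finset.filter_insert, if_pos hr, Finset.card_insert_of_notMem (by simp [hdL])]
        push_cast; ring
      have hm := leaderSum_add_le hρ hf hρf hT hr hTd hfd
      rw [hcF]
      have h1 : b d * (cnt (insert d L) T + c * leaderSum ρ f T) ≤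
          b d * (cnt L F + c * (leaderSum ρ f F - f d.fst)) := by
        have : leaderSum ρ f T ≤ leaderSum ρ f F - f d.fst := by linarith
        gcongr
      have := hbc d
      nlinarith)
  have h0 : boolExp b (Z ∅) = c * leaderSum ρ f H := by
    have : Z ∅ = fun _ => c * leaderSum ρ f H := by
      funext ω
      simp [Z, cnt, addDarts]
    rw [this, boolExp_const]
  rw [h0] at hstep
  refine (boolExp_mono hb fun ω => ?_).trans hstep
  have hle : addDarts H D ω ≤ H ⊔ sampledSubgraph G ω := by
    refine sup_le_sup le_rfl (SimpleGraph.fromEdgeSet_mono ?_)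
    rintro _ ⟨d, _, rfl, h2⟩
    exact ⟨d, rfl, h2⟩
  have hsub : interComponentEdges G (H ⊔ sampledSubgraph G ω) ⊆
      ((D.filter fun d => ¬ (addDarts H D ω).Reachable d.fst d.snd).image
        SimpleGraph.Dart.edge : Finset (Sym2 V)) := by
    rintro _ ⟨u, v, rfl, huv, hne⟩
    rw [Ne, SimpleGraph.ConnectedComponent.eq] at hne
    have hne' : ¬ (addDarts H D ω).Reachable u v := fun h => hne (h.mono hle)
    rw [Finset.mem_coe, Finset.mem_image]
    rcases le_total (f u) (f v) with h | h
    · exact ⟨⟨(u, v), huv⟩, by simpa [hD] using ⟨h, hne'⟩, rfl⟩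
    · exact ⟨⟨(v, u), huv.symm⟩, by simpa [hD] using ⟨h, fun h => hne' h.symm⟩, Sym2.eq_swap⟩
  have h1 := (Set.ncard_le_ncard hsub (Finset.finite_toSet _)).trans
    ((Set.ncard_coe_finset _).le.trans Finset.card_image_le)
  have h2 : ((interComponentEdges G (H ⊔ sampledSubgraph G ω)).ncard : ℝ) ≤
      cnt D (addDarts H D ω) := by
    simp only [cnt]
    exact_mod_cast h1
  have h3 := mul_nonneg hc (leaderSum_nonneg ρ hf (addDarts H D ω))
  simp only [Z]
  linarith

theorem ncard_interComponentEdges_le (G H : SimpleGraph V) :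
    (interComponentEdges G H).ncard ≤ Fintype.card V ^ 2 := by
  classical
  have hsub : interComponentEdges G H ⊆
      ((Finset.univ : Finset (V × V)).image fun x => s(x.1, x.2) : Finset (Sym2 V)) := by
    rintro _ ⟨u, v, rfl, _⟩
    exact Finset.mem_coe.2 (Finset.mem_image.2 ⟨(u, v), Finset.mem_univ _, rfl⟩)
  refine (Set.ncard_le_ncard hsub (Finset.finite_toSet _)).trans
    ((Set.ncard_coe_finset _).le.trans (Finset.card_image_le.trans ?_))
  rw [Finset.card_univ, Fintype.card_prod, sq]

end Sampling

/-! ### Growing a component by attaching clusters -/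

theorem exp_le_one_add_two_mul {t : ℝ} (h0 : 0 ≤ t) (h : t ≤ 1 / 2) : Real.exp t ≤ 1 + 2 * t := by
  have h1 := Real.add_one_le_exp (-t)
  have h2 : Real.exp t * Real.exp (-t) = 1 := by rw [← Real.exp_add]; simp
  nlinarith [Real.exp_pos t]

theorem half_le_one_sub_exp_neg {y z : ℝ} (h0 : 0 ≤ y) (h1 : y ≤ 1) (h : y ≤ z) :
    y / 2 ≤ 1 - Real.exp (-z) := by
  have h2 : Real.exp (-z) ≤ Real.exp (-y) := Real.exp_le_exp.2 (by linarith)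
  have h3 := Real.add_one_le_exp y
  have h4 : Real.exp y * Real.exp (-y) = 1 := by rw [← Real.exp_add]; simp
  nlinarith [Real.exp_pos (-y)]

/-- One step of the growth process: a cluster of size `g`, attached with the probability with
which a vertex of degree `D` samples in the first round, makes the potential decrease on average. -/
theorem growth_step {k d D g : ℝ} (hk : 72 ≤ k) (hkd : k < d) (hDd : D < d) (hg : 1 ≤ g)
    (hgD : D ≤ k ∨ D ≤ 72 * g) :
    k / max k D / 2 * Real.exp (-(k / d * g)) + (1 - k / max k D / 2) * Real.exp (k / (8 * d)) ≤
      1 := by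
  have hk0 : 0 < k := by linarith
  have hd0 : 0 < d := by linarith
  have hkd1 : k / d ≤ 1 := (div_le_one hd0).2 hkd.le
  have hkd0 : 0 < k / d := by positivity
  have ht : k / (8 * d) = k / d / 8 := by field_simp
  have hexp : Real.exp (k / (8 * d)) ≤ 1 + k / d / 4 := by
    rw [ht]
    refine (exp_le_one_add_two_mul (by positivity) (by linarith)).trans (by linarith)
  have hp1 : k / max k D / 2 ≤ 1 := by
    have : k / max k D ≤ 1 := div_le_one_of_le₀ (le_max_left _ _) (by positivity)
    linarith
  have hp0 : 0 ≤ k / max k D / 2 := by positivity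
  -- The hypothesis `72 ≤ k` makes the exponent `k / d * g` at least `D / d` when `k < D`.
  have hmain : k / d / 4 ≤ k / max k D / 2 * (1 - Real.exp (-(k / d * g))) := by
    rcases le_or_gt D k with hD | hD
    · rw [max_eq_left hD, div_self hk0.ne']
      have := half_le_one_sub_exp_neg hkd0.le hkd1 (show k / d ≤ k / d * g by nlinarith)
      linarith
    · rw [max_eq_right hD.le]
      have hD72 : D ≤ 72 * g := hgD.resolve_left (not_le.2 hD)
      have hD0 : 0 < D := by linarith
      have hle : D / d ≤ k / d * g := by
        rw [div_mul_eq_mul_div]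
        gcongr
        nlinarith
      have := half_le_one_sub_exp_neg (by positivity) ((div_le_one hd0).2 hDd.le) hle
      calc k / d / 4 = k / D / 2 * (D / d / 2) := by field_simp; norm_num
        _ ≤ _ := by gcongr
  nlinarith

section Growth

variable {V ι : Type*} [Fintype V]

/-- A vertex `v` whose degree is `D v` is good in `H` when `D v ≤ k`, or its component in `H` has
at least `D v / 72` vertices. -/
def IsGood (k : ℝ) (D : V → ℝ) (H : SimpleGraph V) (v : V) : Prop :=
  D v ≤ k ∨ D v ≤ 72 * (compFinset H v).card

open scoped Classical in
/-- The union of the components in `H` of the vertices `vtx i`, `i ∈ J`. -/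
def unionComp (H : SimpleGraph V) (vtx : ι → V) (J : Finset ι) : Finset V :=
  J.biUnion fun i => compFinset H (vtx i)

theorem mem_unionComp {H : SimpleGraph V} {vtx : ι → V} {J : Finset ι} {u : V} :
    u ∈ unionComp H vtx J ↔ ∃ i ∈ J, H.Reachable (vtx i) u := by
  simp [unionComp]

open scoped Classical in
/-- The potential of the growth process: `J` is the set of the clusters attached so far, `Q` the
set of those that are still to be examined. A vertex of an attached cluster has weight
`k / d + k / (8 * d)`: the first term accounts for the growth, and the second one for an element
of `Q` that is lost because its cluster has already been attached. -/
def growthPotential (k d : ℝ) (H : SimpleGraph V) (vtx : ι → V) (J Q : Finset ι) : ℝ :=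
  Real.exp (-((k / d + k / (8 * d)) * (unionComp H vtx J).card) -
    k / (8 * d) * (Q.filter fun j => vtx j ∉ unionComp H vtx J).card)

open scoped Classical in
theorem growthPotential_step [DecidableEq ι] {k d : ℝ} (hk : 72 ≤ k) (hkd : k < d) (D : V → ℝ)
    (H : SimpleGraph V) (vtx : ι → V) {J Q : Finset ι} (hinj : Set.InjOn vtx Q)
    {i : ι} (hi : i ∈ Q) (hD : D (vtx i) < d) (hgood : IsGood k D H (vtx i)) :
    k / max k (D (vtx i)) / 2 * growthPotential k d H vtx (insert i J) (Q.erase i) +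
      (1 - k / max k (D (vtx i)) / 2) * growthPotential k d H vtx J (Q.erase i) ≤
    growthPotential k d H vtx J Q := by
  have hk0 : 0 < k := by linarith
  have hd0 : 0 < d := by linarith
  have hp1 : k / max k (D (vtx i)) / 2 ≤ 1 := by
    have : k / max k (D (vtx i)) ≤ 1 := div_le_one_of_le₀ (le_max_left _ _) (by positivity)
    linarith
  have hp0 : 0 ≤ k / max k (D (vtx i)) / 2 := by positivity
  by_cases hiS : vtx i ∈ unionComp H vtx J
  · have hU : unionComp H vtx (insert i J) = unionComp H vtx J := by
      obtain ⟨j, hj, hr⟩ := mem_unionComp.1 hiS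
      ext u
      simp only [mem_unionComp, Finset.mem_insert]
      constructor
      · rintro ⟨j', rfl | hj', hr'⟩
        · exact ⟨j, hj, hr.trans hr'⟩
        · exact ⟨j', hj', hr'⟩
      · rintro ⟨j', hj', hr'⟩
        exact ⟨j', Or.inr hj', hr'⟩
    have hQ : ((Q.erase i).filter fun j => vtx j ∉ unionComp H vtx J) =
        Q.filter fun j => vtx j ∉ unionComp H vtx J := by
      ext j
      simp only [Finset.mem_filter, Finset.mem_erase]
      constructor
      · tauto
      · rintro ⟨h1, h2⟩
        exact ⟨⟨fun e => h2 (e ▸ hiS), h1⟩, h2⟩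
    simp only [growthPotential, hU, hQ]
    exact le_of_eq (by ring)
  · set g := (compFinset H (vtx i)).card with hg
    have hg1 : (1 : ℝ) ≤ g := by
      have : 0 < g := Finset.card_pos.2 ⟨vtx i, by simp⟩
      exact_mod_cast this
    have hU : unionComp H vtx (insert i J) = unionComp H vtx J ∪ compFinset H (vtx i) := by
      simp [unionComp, Finset.union_comm]
    have hdisj : Disjoint (unionComp H vtx J) (compFinset H (vtx i)) := by
      refine Finset.disjoint_left.2 fun u hu hu' => hiS ?_
      obtain ⟨j, hj, hr⟩ := mem_unionComp.1 hu
      exact mem_unionComp.2 ⟨j, hj, hr.trans (mem_compFinset.1 hu').symm⟩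
    have hUcard : ((unionComp H vtx (insert i J)).card : ℝ) = (unionComp H vtx J).card + g := by
      rw [hU, Finset.card_union_of_disjoint hdisj]
      push_cast; rfl
    have hQt : ((Q.filter fun j => vtx j ∉ unionComp H vtx J).card : ℝ) ≤
        ((Q.erase i).filter fun j => vtx j ∉ unionComp H vtx (insert i J)).card + g := by
      have h1 : (Q.filter fun j => vtx j ∉ unionComp H vtx J) ⊆
          ((Q.erase i).filter fun j => vtx j ∉ unionComp H vtx (insert i J)) ∪
            Q.filter fun j => vtx j ∈ compFinset H (vtx i) := by
        intro j hj
        simp only [Finset.mem_filter, Finset.mem_union, Finset.mem_erase, hU] at hj ⊢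
        by_cases hjc : vtx j ∈ compFinset H (vtx i)
        · exact Or.inr ⟨hj.1, hjc⟩
        · refine Or.inl ⟨⟨fun e => hjc (by simp [e]), hj.1⟩, by tauto⟩
      have h2 : (Q.filter fun j => vtx j ∈ compFinset H (vtx i)).card ≤ g :=
        Finset.card_le_card_of_injOn vtx (fun j hj => (Finset.mem_filter.1 hj).2)
          (hinj.mono fun j hj => (Finset.mem_filter.1 hj).1)
      have h3 := (Finset.card_le_card h1).trans (Finset.card_union_le _ _)
      exact_mod_cast h3.trans (Nat.add_le_add_left h2 _)
    have hQf : ((Q.filter fun j => vtx j ∉ unionComp H vtx J).card : ℝ) =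
        ((Q.erase i).filter fun j => vtx j ∉ unionComp H vtx J).card + 1 := by
      rw [Finset.filter_erase, ← Nat.cast_add_one, Finset.card_erase_add_one]
      exact Finset.mem_filter.2 ⟨hi, hiS⟩
    -- Attaching the cluster loses at most `g` elements of `Q`, which its `g` vertices pay for.
    have hT : growthPotential k d H vtx (insert i J) (Q.erase i) ≤
        growthPotential k d H vtx J Q * Real.exp (-(k / d * g)) := by
      rw [growthPotential, growthPotential, ← Real.exp_add, Real.exp_le_exp, hUcard]
      have := mul_le_mul_of_nonneg_left hQt (show 0 ≤ k / (8 * d) by positivity)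
      linarith
    have hFa : growthPotential k d H vtx J (Q.erase i) =
        growthPotential k d H vtx J Q * Real.exp (k / (8 * d)) := by
      rw [growthPotential, growthPotential, ← Real.exp_add, hQf]
      congr 1
      ring
    have hpos : 0 < growthPotential k d H vtx J Q := Real.exp_pos _
    have hstep := growth_step hk hkd hD hg1 hgood
    rw [hFa]
    have h1 := mul_le_mul_of_nonneg_left hT hp0
    have h2 := mul_le_mul_of_nonneg_left hstep hpos.le
    linarith

open scoped Classical in
/-- If at least `d / 4` of the clusters around a vertex are good, then the union of those that
get attached is smaller than `d / 72` only with exponentially small probability. The clusters may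
depend on the other coordinates. -/
theorem boolExp_growth_le [Fintype ι] [DecidableEq ι] {p : ι → ℝ}
    (hp : ∀ i, 0 ≤ p i ∧ p i ≤ 1) {k d : ℝ}
    (hk : 72 ≤ k) (hkd : k < d) (D : V → ℝ) (vtx : ι → V) (F : (ι → Bool) → SimpleGraph V)
    (A : Finset ι) (hinj : Set.InjOn vtx A)
    (hF : ∀ i ∈ A, ∀ ω b, F (Function.update ω i b) = F ω) (hD : ∀ i ∈ A, D (vtx i) < d)
    (hpA : ∀ i ∈ A, p i = k / max k (D (vtx i)) / 2) :
    boolExp p (fun ω =>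
      if d ≤ 4 * (A.filter fun i => IsGood k D (F ω) (vtx i)).card ∧
        72 * ((unionComp (F ω) vtx
          ((A.filter fun i => IsGood k D (F ω) (vtx i)).filter fun i => ω i = true)).card : ℝ) < d
      then 1 else 0) ≤ Real.exp (-(k / 64)) := by
  have hk0 : 0 < k := by linarith
  have hd0 : 0 < d := by linarith
  let A' : (ι → Bool) → Finset ι := fun ω => A.filter fun i => IsGood k D (F ω) (vtx i)
  let Z : Finset ι → (ι → Bool) → ℝ := fun L ω =>
    if d ≤ 4 * (A' ω).card then
      growthPotential k d (F ω) vtx ((A' ω ∩ L).filter fun i => ω i = true) (A' ω \ L)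
    else 0
  have hstep := boolExp_potential_le hp id Z A (by
    intro L i hi hiL ω
    have hA' : ∀ b, A' (Function.update ω i b) = A' ω := fun b => by simp only [A', hF i hi]
    have hcongr : ∀ b, ∀ j ∈ L, Function.update ω i b j = ω j := fun b j hj =>
      Function.update_of_ne (fun e => hiL (by rwa [← e])) _ _
    simp only [coordAvg, id, Z, hA', hF i hi]
    split_ifs with hd
    swap
    · simp
    have hJf : ((A' ω ∩ insert i L).filter fun j => Function.update ω i false j = true) =
        (A' ω ∩ L).filter fun j => ω j = true := by
      ext j
      simp only [Finset.mem_filter, Finset.mem_inter, Finset.mem_insert]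
      constructor
      · rintro ⟨⟨h1, rfl | h2⟩, h3⟩
        · simp at h3
        · exact ⟨⟨h1, h2⟩, by rwa [hcongr _ _ h2] at h3⟩
      · rintro ⟨⟨h1, h2⟩, h3⟩
        exact ⟨⟨h1, Or.inr h2⟩, by rwa [hcongr _ _ h2]⟩
    rw [hJf]
    by_cases hiA : i ∈ A' ω
    · have hJt : ((A' ω ∩ insert i L).filter fun j => Function.update ω i true j = true) =
          insert i ((A' ω ∩ L).filter fun j => ω j = true) := by
        ext j
        simp only [Finset.mem_filter, Finset.mem_inter, Finset.mem_insert]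
        constructor
        · rintro ⟨⟨h1, rfl | h2⟩, h3⟩
          · exact Or.inl rfl
          · exact Or.inr ⟨⟨h1, h2⟩, by rwa [hcongr _ _ h2] at h3⟩
        · rintro (rfl | ⟨⟨h1, h2⟩, h3⟩)
          · exact ⟨⟨hiA, Or.inl rfl⟩, by simp⟩
          · exact ⟨⟨h1, Or.inr h2⟩, by rwa [hcongr _ _ h2]⟩
      have hQ : A' ω \ insert i L = (A' ω \ L).erase i := by
        ext j
        simp only [Finset.mem_sdiff, Finset.mem_insert, Finset.mem_erase]
        tauto
      rw [hJt, hQ, hpA i hi]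
      refine growthPotential_step hk hkd D (F ω) vtx (hinj.mono ?_) ?_ (hD i hi)
        (Finset.mem_filter.1 hiA).2
      · intro j hj
        exact (Finset.mem_filter.1 (Finset.mem_sdiff.1 hj).1).1
      · exact Finset.mem_sdiff.2 ⟨hiA, hiL⟩
    · have hJt : ((A' ω ∩ insert i L).filter fun j => Function.update ω i true j = true) =
          (A' ω ∩ L).filter fun j => ω j = true := by
        ext j
        simp only [Finset.mem_filter, Finset.mem_inter, Finset.mem_insert]
        constructor
        · rintro ⟨⟨h1, rfl | h2⟩, h3⟩
          · exact absurd h1 hiA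
          · exact ⟨⟨h1, h2⟩, by rwa [hcongr _ _ h2] at h3⟩
        · rintro ⟨⟨h1, h2⟩, h3⟩
          exact ⟨⟨h1, Or.inr h2⟩, by rwa [hcongr _ _ h2]⟩
      have hQ : A' ω \ insert i L = A' ω \ L := by
        ext j
        simp only [Finset.mem_sdiff, Finset.mem_insert]
        constructor
        · tauto
        · rintro ⟨h1, h2⟩
          exact ⟨h1, by rintro (rfl | h3); exacts [hiA h1, h2 h3]⟩
      rw [hJt, hQ]
      exact le_of_eq (by ring))
  have h0 : boolExp p (Z ∅) ≤ Real.exp (-(k / 32)) := by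
    rw [← boolExp_const (p := p) (Real.exp (-(k / 32)))]
    refine boolExp_mono hp fun ω => ?_
    simp only [Z]
    split_ifs with hd
    · rw [growthPotential, Real.exp_le_exp]
      simp only [Finset.inter_empty, Finset.filter_empty, Finset.sdiff_empty, unionComp,
        Finset.biUnion_empty, Finset.card_empty, Finset.notMem_empty, not_false_eq_true,
        Finset.filter_true]
      have h1 : k / 32 = k / (8 * d) * (d / 4) := by field_simp; norm_num
      have h2 : k / (8 * d) * (d / 4) ≤ k / (8 * d) * (A' ω).card := by
        have : d / 4 ≤ (A' ω).card := by linarith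
        gcongr
      simp only [Nat.cast_zero]
      linarith
    · positivity
  have h1 : boolExp p (fun ω =>
      if d ≤ 4 * (A' ω).card ∧
        72 * ((unionComp (F ω) vtx ((A' ω).filter fun i => ω i = true)).card : ℝ) < d
      then 1 else 0) ≤ boolExp p (fun ω => Real.exp (k / 64) * Z A ω) := by
    refine boolExp_mono hp fun ω => ?_
    split_ifs with h
    · have hA : A' ω ∩ A = A' ω := Finset.inter_eq_left.2 (Finset.filter_subset _ _)
      have hA0 : A' ω \ A = ∅ := Finset.sdiff_eq_empty_iff_subset.2 (Finset.filter_subset _ _)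
      simp only [Z, if_pos h.1, hA, hA0, growthPotential]
      rw [← Real.exp_add]
      refine Real.one_le_exp ?_
      have h2 : (k / d + k / (8 * d)) * (d / 72) = k / 64 := by field_simp; norm_num
      have h3 : (k / d + k / (8 * d)) *
          (unionComp (F ω) vtx ((A' ω).filter fun i => ω i = true)).card ≤
          (k / d + k / (8 * d)) * (d / 72) := by
        have : ((unionComp (F ω) vtx ((A' ω).filter fun i => ω i = true)).card : ℝ) ≤ d / 72 := by
          linarith [h.2]
        gcongr
      simp only [Finset.filter_empty, Finset.card_empty, Nat.cast_zero]
      linarith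
    · simp only [Z]
      split_ifs
      · exact mul_nonneg (Real.exp_pos _).le (Real.exp_pos _).le
      · simp
  refine h1.trans ?_
  rw [boolExp_const_mul]
  calc Real.exp (k / 64) * boolExp p (Z A) ≤ Real.exp (k / 64) * Real.exp (-(k / 32)) := by
        gcongr
        exact hstep.trans h0
    _ = Real.exp (-(k / 64)) := by
        rw [← Real.exp_add]
        congr 1
        ring

end Growth

/-! ### Components of the first round are large -/

section FirstRound

variable {V : Type*} [Fintype V] {G : SimpleGraph V}

/-- The sampled subgraph without the edges at `x`. -/
def sampledAvoiding (G : SimpleGraph V) (x : V) (ω : G.Dart → Bool) : SimpleGraph V :=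
  SimpleGraph.fromEdgeSet {e | x ∉ e ∧ ∃ d : G.Dart, d.edge = e ∧ ω d = true}

omit [Fintype V] in
theorem sampledAvoiding_le (x : V) (ω : G.Dart → Bool) :
    sampledAvoiding G x ω ≤ sampledSubgraph G ω :=
  SimpleGraph.fromEdgeSet_mono fun _ he => he.2

omit [Fintype V] in
open scoped Classical in
theorem sampledAvoiding_update {x : V} {d : G.Dart} (hd : d.snd = x) (ω : G.Dart → Bool)
    (b : Bool) : sampledAvoiding G x (Function.update ω d b) = sampledAvoiding G x ω := by
  unfold sampledAvoiding
  congr 1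
  ext e
  simp only [Set.mem_ofPred_eq]
  refine and_congr_right fun hx => exists_congr fun d' => and_congr_right fun he => ?_
  have hne : d' ≠ d := by
    rintro rfl
    refine hx ?_
    rw [← he, ← hd]
    exact Sym2.mem_mk_right _ _
  rw [Function.update_of_ne hne]

omit [Fintype V] in
/-- Deleting the edges at `x` does not affect the components that do not contain `x`. -/
theorem sampledAvoiding_reachable {x w u : V} {ω : G.Dart → Bool}
    (hwx : ¬ (sampledSubgraph G ω).Reachable w x) (hwu : (sampledSubgraph G ω).Reachable w u) :
    (sampledAvoiding G x ω).Reachable w u := by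
  rw [SimpleGraph.reachable_iff_reflTransGen] at hwu
  induction hwu with
  | refl => exact SimpleGraph.Reachable.refl _
  | @tail y z hy hyz ih =>
    have hwy : (sampledSubgraph G ω).Reachable w y :=
      (SimpleGraph.reachable_iff_reflTransGen _ _).2 hy
    refine ih.trans (SimpleGraph.Adj.reachable ?_)
    have hyx : x ≠ y := by rintro rfl; exact hwx hwy
    have hzx : x ≠ z := by rintro rfl; exact hwx (hwy.trans hyz.reachable)
    have h := hyz
    rw [sampledSubgraph, SimpleGraph.fromEdgeSet_adj] at h
    rw [sampledAvoiding, SimpleGraph.fromEdgeSet_adj]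
    exact ⟨⟨by simp [hyx, hzx], h.1⟩, h.2⟩

omit [Fintype V] in
theorem sampledSubgraph_adj {d : G.Dart} {ω : G.Dart → Bool} (h : ω d = true) :
    (sampledSubgraph G ω).Adj d.fst d.snd := by
  rw [sampledSubgraph, SimpleGraph.fromEdgeSet_adj]
  exact ⟨⟨d, rfl, h⟩, d.adj.ne⟩

variable [DecidableRel G.Adj]

open scoped Classical in
/-- The darts that point at `x` from vertices of degree less than `d`. -/
def lowDarts (G : SimpleGraph V) [DecidableRel G.Adj] (d : ℝ) (x : V) : Finset G.Dart :=
  {i | i.snd = x ∧ (G.degree i.fst : ℝ) < d}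

open scoped Classical in
/-- The darts in `lowDarts` that start in a good cluster of the sampled graph without `x`. -/
def goodLowDarts (G : SimpleGraph V) [DecidableRel G.Adj] (k d : ℝ) (x : V) (ω : G.Dart → Bool) :
    Finset G.Dart :=
  (lowDarts G d x).filter fun i =>
    IsGood k (fun v => (G.degree v : ℝ)) (sampledAvoiding G x ω) i.fst

open scoped Classical in
/-- The darts that leave `T` towards vertices of degree at least `d`. -/
def highDarts (G : SimpleGraph V) [DecidableRel G.Adj] (d : ℝ) (T : Finset V) : Finset G.Dart :=
  {i | i.fst ∈ T ∧ i.snd ∉ T ∧ d ≤ G.degree i.snd}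

open scoped Classical in
/-- The event that `x` has many neighbours of degree less than `d` in good clusters, but the
clusters attached to `x` by the choices of these neighbours are small. -/
def StuckAt (G : SimpleGraph V) [DecidableRel G.Adj] (k d : ℝ) (x : V) (ω : G.Dart → Bool) : Prop :=
  d ≤ 4 * (goodLowDarts G k d x ω).card ∧
    72 * ((unionComp (sampledAvoiding G x ω) (fun i : G.Dart => i.fst)
      ((goodLowDarts G k d x ω).filter fun i => ω i = true)).card : ℝ) < d

open scoped Classical in
/-- The event that each vertex of `T` has many neighbours of degree at least `d` outside `T`, but
no vertex of `T` chooses any of them. -/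
def StuckIn (G : SimpleGraph V) [DecidableRel G.Adj] (d : ℝ) (T : Finset V) (ω : G.Dart → Bool) :
    Prop :=
  (∀ x ∈ T, d ≤ G.degree x ∧
    (G.degree x : ℝ) ≤ 4 * ((highDarts G d T).filter fun i => i.fst = x).card) ∧
  ∀ i ∈ highDarts G d T, ω i = false

open scoped Classical in
theorem degree_le_darts (d : ℝ) (x : V) (T : Finset V) (hx : x ∈ T) :
    G.degree x ≤ (lowDarts G d x).card + T.card +
      ((highDarts G d T).filter fun i => i.fst = x).card := by
  have h0 := G.dart_fst_fiber_card_eq_degree x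
  rw [← h0]
  have hsub : (Finset.univ.filter fun i : G.Dart => i.fst = x) ⊆
      (lowDarts G d x).image SimpleGraph.Dart.symm ∪
        (Finset.univ.filter fun i : G.Dart => i.fst = x ∧ i.snd ∈ T) ∪
        (highDarts G d T).filter fun i => i.fst = x := by
    intro i hi
    have hix : i.fst = x := by simpa using hi
    by_cases h1 : (G.degree i.snd : ℝ) < d
    · refine Finset.mem_union_left _ (Finset.mem_union_left _ (Finset.mem_image.2
        ⟨i.symm, ?_, SimpleGraph.Dart.symm_symm i⟩))
      exact Finset.mem_filter.2 ⟨Finset.mem_univ _, hix, h1⟩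
    · by_cases h2 : i.snd ∈ T
      · exact Finset.mem_union_left _ (Finset.mem_union_right _ (by simp [hix, h2]))
      · refine Finset.mem_union_right _ ?_
        simp only [highDarts, Finset.mem_filter, Finset.mem_univ, true_and]
        exact ⟨⟨hix ▸ hx, h2, not_lt.1 h1⟩, hix⟩
  have hT : (Finset.univ.filter fun i : G.Dart => i.fst = x ∧ i.snd ∈ T).card ≤ T.card := by
    refine Finset.card_le_card_of_injOn (fun i => i.snd) (fun i hi => ?_) ?_
    · exact (by simpa using hi : i.fst = x ∧ i.snd ∈ T).2
    · intro i hi j hj hij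
      have hi' : i.fst = x ∧ i.snd ∈ T := by simpa using hi
      have hj' : j.fst = x ∧ j.snd ∈ T := by simpa using hj
      exact SimpleGraph.Dart.ext _ _ (Prod.ext (hi'.1.trans hj'.1.symm) hij)
  calc _ ≤ _ := Finset.card_le_card hsub
    _ ≤ _ := Finset.card_union_le _ _
    _ ≤ _ := by
      gcongr
      exact (Finset.card_union_le _ _).trans (add_le_add Finset.card_image_le hT)

/-- If some vertex is not good, then one of least degree witnesses one of the two stuck events:
either some vertex of its component has many neighbours of smaller degree (which are all good), or
the vertices of its component whose degree is not smaller form a set that no choice leaves. -/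
theorem exists_stuck {k : ℝ} (hk : 0 < k) {ω : G.Dart → Bool}
    (h : ∃ v, ¬ IsGood k (fun v => (G.degree v : ℝ)) (sampledSubgraph G ω) v) :
    ∃ v, k < G.degree v ∧ ((∃ x, StuckAt G k (G.degree v) x ω) ∨
      ∃ T : Finset V, T.Nonempty ∧ StuckIn G (G.degree v) T ω) := by
  classical
  obtain ⟨v, hv, hmin⟩ := Finset.exists_min_image (Finset.univ.filter fun v =>
    ¬ IsGood k (fun v => (G.degree v : ℝ)) (sampledSubgraph G ω) v) (fun v => G.degree v)
    (by simpa [Finset.Nonempty] using h)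
  have hvbad := (Finset.mem_filter.1 hv).2
  obtain ⟨hkd, hC⟩ : k < G.degree v ∧
      72 * ((compFinset (sampledSubgraph G ω) v).card : ℝ) < G.degree v := by
    simpa [IsGood] using hvbad
  have hgood : ∀ w, (G.degree w : ℝ) < G.degree v →
      IsGood k (fun v => (G.degree v : ℝ)) (sampledSubgraph G ω) w := by
    intro w hw
    by_contra hbad
    exact (Nat.cast_lt.1 hw).not_ge (hmin w (by simpa using hbad))
  refine ⟨v, hkd, ?_⟩
  generalize hd : (G.degree v : ℝ) = d at *
  have hd0 : 0 < d := hk.trans hkd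
  set H := sampledSubgraph G ω with hH
  set S := compFinset H v with hS
  set T := S.filter fun x => d ≤ G.degree x with hT
  have hvT : v ∈ T := by simp [hT, hS, hd]
  have hTS : (T.card : ℝ) ≤ S.card := by exact_mod_cast Finset.card_filter_le _ _
  by_cases hlow : ∃ x ∈ T, (G.degree x : ℝ) ≤ 2 * (lowDarts G d x).card
  · left
    obtain ⟨x, hxT, hx⟩ := hlow
    have hxS : H.Reachable v x := by simpa [hS] using (Finset.mem_filter.1 hxT).1
    have hxd : d ≤ G.degree x := (Finset.mem_filter.1 hxT).2
    refine ⟨x, ?_, ?_⟩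
    · have hsub : lowDarts G d x ⊆ goodLowDarts G k d x ω ∪
          (lowDarts G d x).filter fun i => i.fst ∈ S := by
        intro i hi
        by_cases hiS : i.fst ∈ S
        · exact Finset.mem_union_right _ (Finset.mem_filter.2 ⟨hi, hiS⟩)
        · refine Finset.mem_union_left _ (Finset.mem_filter.2 ⟨hi, ?_⟩)
          have hi' : i.snd = x ∧ (G.degree i.fst : ℝ) < d := by simpa [lowDarts] using hi
          refine (hgood i.fst hi'.2).imp id fun hc => hc.trans ?_
          have hnx : ¬ H.Reachable i.fst x := fun hr => hiS (by simpa [hS] using hxS.trans hr.symm)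
          have : compFinset H i.fst ⊆ compFinset (sampledAvoiding G x ω) i.fst := fun u hu =>
            mem_compFinset.2 (sampledAvoiding_reachable hnx (mem_compFinset.1 hu))
          gcongr
      have hcS : ((lowDarts G d x).filter fun i => i.fst ∈ S).card ≤ S.card := by
        refine Finset.card_le_card_of_injOn (fun i => i.fst)
          (fun i hi => (Finset.mem_filter.1 hi).2) ?_
        intro i hi j hj hij
        have hi' : i.snd = x ∧ (G.degree i.fst : ℝ) < d := by
          simpa [lowDarts] using (Finset.mem_filter.1 hi).1
        have hj' : j.snd = x ∧ (G.degree j.fst : ℝ) < d := by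
          simpa [lowDarts] using (Finset.mem_filter.1 hj).1
        exact SimpleGraph.Dart.ext _ _ (Prod.ext hij (hi'.1.trans hj'.1.symm))
      have h1 : ((lowDarts G d x).card : ℝ) ≤ (goodLowDarts G k d x ω).card + S.card := by
        exact_mod_cast (Finset.card_le_card hsub).trans ((Finset.card_union_le _ _).trans
          (Nat.add_le_add_left hcS _))
      linarith
    · refine lt_of_le_of_lt ?_ hC
      have : unionComp (sampledAvoiding G x ω) (fun i : G.Dart => i.fst)
          ((goodLowDarts G k d x ω).filter fun i => ω i = true) ⊆ S := by
        intro u hu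
        obtain ⟨i, hi, hr⟩ := mem_unionComp.1 hu
        obtain ⟨hi1, hi2⟩ := Finset.mem_filter.1 hi
        have hi' : i.snd = x := by
          have := (Finset.mem_filter.1 hi1).1
          exact (by simpa [lowDarts] using this : i.snd = x ∧ (G.degree i.fst : ℝ) < d).1
        have hadj : H.Adj i.fst x := hi' ▸ sampledSubgraph_adj hi2
        exact mem_compFinset.2 (hxS.trans (hadj.symm.reachable.trans
          (hr.mono (sampledAvoiding_le x ω))))
      gcongr
  · right
    push Not at hlow
    refine ⟨T, ⟨v, hvT⟩, fun x hxT => ?_, fun i hi => ?_⟩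
    · have hxd : d ≤ G.degree x := (Finset.mem_filter.1 hxT).2
      have h1 : (G.degree x : ℝ) ≤ (lowDarts G d x).card + T.card +
          ((highDarts G d T).filter fun i => i.fst = x).card := by
        exact_mod_cast degree_le_darts d x T hxT
      have h2 := hlow x hxT
      refine ⟨hxd, ?_⟩
      linarith
    · by_contra hne
      obtain ⟨h1, h2, h3⟩ : i.fst ∈ T ∧ i.snd ∉ T ∧ d ≤ G.degree i.snd := by
        simpa [highDarts] using hi
      have hadj : H.Adj i.fst i.snd := sampledSubgraph_adj (by simpa using hne)
      have hr : H.Reachable v i.fst := by simpa [hS] using (Finset.mem_filter.1 h1).1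
      exact h2 (Finset.mem_filter.2 ⟨by simpa [hS] using hr.trans hadj.reachable, h3⟩)

/-- The sampling probabilities of the first round. -/
def firstProb (G : SimpleGraph V) [DecidableRel G.Adj] (k : ℝ) (i : G.Dart) : ℝ :=
  k / max k (G.degree i.fst) / 2

theorem div_max_mem {k : ℝ} (hk : 0 < k) (D : ℝ) : 0 < k / max k D ∧ k / max k D ≤ 1 :=
  ⟨div_pos hk (lt_max_of_lt_left hk), div_le_one_of_le₀ (le_max_left _ _) (le_max_of_le_left hk.le)⟩

theorem firstProb_mem {k : ℝ} (hk : 0 < k) (i : G.Dart) :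
    0 ≤ firstProb G k i ∧ firstProb G k i ≤ 1 := by
  have := div_max_mem hk (G.degree i.fst)
  constructor <;> rw [firstProb] <;> linarith

open scoped Classical in
theorem boolExp_stuckAt_le {k d : ℝ} (hk : 72 ≤ k) (hkd : k < d) (x : V) :
    boolExp (firstProb G k) (fun ω => if StuckAt G k d x ω then 1 else 0) ≤
      Real.exp (-(k / 64)) := by
  have hmem : ∀ i ∈ lowDarts G d x, i.snd = x ∧ (G.degree i.fst : ℝ) < d := fun i hi => by
    simpa [lowDarts] using hi
  have h := boolExp_growth_le (p := firstProb G k) (firstProb_mem (by linarith)) hk hkd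
    (fun v => (G.degree v : ℝ))
    (fun i : G.Dart => i.fst) (sampledAvoiding G x) (lowDarts G d x) ?_ ?_ ?_ ?_
  · convert h
    rfl
  · intro i hi j hj hij
    exact SimpleGraph.Dart.ext _ _ (Prod.ext hij ((hmem i hi).1.trans (hmem j hj).1.symm))
  · intro i hi ω b
    convert sampledAvoiding_update (hmem i hi).1 ω b
  · exact fun i hi => (hmem i hi).2
  · exact fun i _ => rfl

open scoped Classical in
theorem boolExp_stuckIn_le {k d : ℝ} (hk : 0 < k) (hkd : k < d) (T : Finset V) :
    boolExp (firstProb G k) (fun ω => if StuckIn G d T ω then 1 else 0) ≤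
      Real.exp (-(k / 8)) ^ T.card := by
  by_cases hT : ∀ x ∈ T, d ≤ G.degree x ∧
    (G.degree x : ℝ) ≤ 4 * ((highDarts G d T).filter fun i => i.fst = x).card
  swap
  · have hfalse : ∀ ω, ¬ StuckIn G d T ω := fun ω h => hT h.1
    simp only [hfalse, if_false, boolExp_const]
    positivity
  have hiff : ∀ ω, StuckIn G d T ω ↔ ∀ i ∈ highDarts G d T, ω i = false := fun ω =>
    and_iff_right hT
  simp only [hiff]
  rw [boolExp_forall_false, ← Finset.prod_fiberwise_of_maps_to (t := T) (g := fun i => i.fst)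
    (fun i hi => (by simpa [highDarts] using hi :
      i.fst ∈ T ∧ i.snd ∉ T ∧ d ≤ G.degree i.snd).1), ← Finset.prod_const]
  refine Finset.prod_le_prod (fun x _ => Finset.prod_nonneg fun i _ => ?_) fun x hx => ?_
  · linarith [(firstProb_mem hk i).2]
  · obtain ⟨h1, h2⟩ := hT x hx
    set m := ((highDarts G d T).filter fun i => i.fst = x).card
    have hx0 : (0 : ℝ) < G.degree x := by linarith
    calc ∏ i ∈ (highDarts G d T).filter (fun i => i.fst = x), (1 - firstProb G k i)
        ≤ ∏ i ∈ (highDarts G d T).filter (fun i => i.fst = x),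
            Real.exp (-(k / G.degree x / 2)) := by
          refine Finset.prod_le_prod (fun i _ => ?_) fun i hi => ?_
          · linarith [(firstProb_mem hk i).2]
          · have hix : i.fst = x := (Finset.mem_filter.1 hi).2
            rw [firstProb, hix, max_eq_right (by linarith)]
            exact Real.one_sub_le_exp_neg _
      _ = Real.exp (-(k / G.degree x / 2) * m) := by
          rw [Finset.prod_const, ← Real.exp_nat_mul, mul_comm]
      _ ≤ Real.exp (-(k / 8)) := by
          rw [Real.exp_le_exp]
          have : k / 8 = k / G.degree x / 2 * (G.degree x / 4) := by field_simp; norm_num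
          have h3 : k / G.degree x / 2 * (G.degree x / 4) ≤ k / G.degree x / 2 * m := by
            gcongr
            linarith
          linarith

open scoped Classical in
/-- With high probability every component of the first round is large. -/
theorem boolExp_exists_not_good_le {k : ℝ} (hk : 72 ≤ k)
    (hδ : Fintype.card V * Real.exp (-(k / 8)) ≤ 1 / 2) :
    boolExp (firstProb G k) (fun ω =>
      if ∃ v, ¬ IsGood k (fun v => (G.degree v : ℝ)) (sampledSubgraph G ω) v then 1 else 0) ≤
      3 * (Fintype.card V : ℝ) ^ 2 * Real.exp (-(k / 64)) := by
  have hk0 : 0 < k := by linarith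
  set n : ℝ := (Fintype.card V : ℝ) with hn
  have hp := firstProb_mem (G := G) hk0
  let B : Finset V := Finset.univ.filter fun v => k < G.degree v
  let P : Finset (Finset V) := (Finset.univ : Finset V).powerset.erase ∅
  have hunion : ∀ ω : G.Dart → Bool,
      (if ∃ v, ¬ IsGood k (fun v => (G.degree v : ℝ)) (sampledSubgraph G ω) v
        then (1 : ℝ) else 0) ≤
      ∑ v ∈ B, ((∑ x : V, if StuckAt G k (G.degree v) x ω then (1 : ℝ) else 0) +
        ∑ T ∈ P, if StuckIn G (G.degree v) T ω then (1 : ℝ) else 0) := by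
    intro ω
    have hnn : ∀ {Q : Prop} [Decidable Q], (0 : ℝ) ≤ if Q then 1 else 0 := by
      intro Q _; split_ifs <;> norm_num
    split_ifs with h
    · obtain ⟨v, hv, h⟩ := exists_stuck hk0 h
      refine le_trans ?_ (Finset.single_le_sum (fun v _ => add_nonneg
        (Finset.sum_nonneg fun x _ => hnn) (Finset.sum_nonneg fun T _ => hnn))
        (show v ∈ B by simpa [B] using hv))
      rcases h with ⟨x, hx⟩ | ⟨T, hT, hTs⟩
      · have h1 := Finset.single_le_sum (f := fun x => if StuckAt G k (G.degree v) x ω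
          then (1 : ℝ) else 0) (fun x _ => hnn) (Finset.mem_univ x)
        have h2 : (0 : ℝ) ≤ ∑ T ∈ P, if StuckIn G (G.degree v) T ω then (1 : ℝ) else 0 :=
          Finset.sum_nonneg fun T _ => hnn
        simp only [hx, if_true] at h1
        linarith
      · have h1 := Finset.single_le_sum (f := fun T => if StuckIn G (G.degree v) T ω
          then (1 : ℝ) else 0) (s := P) (fun x _ => hnn) (by simpa [P] using hT.ne_empty)
        have h2 : (0 : ℝ) ≤ ∑ x : V, if StuckAt G k (G.degree v) x ω then (1 : ℝ) else 0 :=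
          Finset.sum_nonneg fun T _ => hnn
        simp only [hTs, if_true] at h1
        linarith
    · exact Finset.sum_nonneg fun v _ => add_nonneg
        (Finset.sum_nonneg fun x _ => hnn) (Finset.sum_nonneg fun T _ => hnn)
  have hpow : ∑ T ∈ P, Real.exp (-(k / 8)) ^ T.card ≤ 2 * (n * Real.exp (-(k / 8))) := by
    have h1 := Finset.sum_pow_mul_eq_add_pow (Real.exp (-(k / 8))) 1 (Finset.univ : Finset V)
    simp only [one_pow, mul_one] at h1
    have h2 := Finset.add_sum_erase (Finset.univ : Finset V).powerset
      (fun T => Real.exp (-(k / 8)) ^ T.card) (Finset.empty_mem_powerset _)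
    simp only [Finset.card_empty, pow_zero] at h2
    have h3 : (Real.exp (-(k / 8)) + 1) ^ (Finset.univ : Finset V).card ≤
        Real.exp (n * Real.exp (-(k / 8))) := by
      rw [Finset.card_univ, Real.exp_nat_mul]
      gcongr
      exact Real.add_one_le_exp _
    have h4 := exp_le_one_add_two_mul (by positivity) hδ
    simp only [P]
    linarith
  calc _ ≤ _ := boolExp_mono hp hunion
    _ = ∑ v ∈ B, ((∑ x : V, boolExp (firstProb G k)
          (fun ω => if StuckAt G k (G.degree v) x ω then 1 else 0)) +
        ∑ T ∈ P, boolExp (firstProb G k)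
          (fun ω => if StuckIn G (G.degree v) T ω then 1 else 0)) := by
        simp only [boolExp_sum, boolExp_add]
    _ ≤ ∑ v ∈ B, ((∑ x : V, Real.exp (-(k / 64))) + ∑ T ∈ P, Real.exp (-(k / 8)) ^ T.card) := by
        refine Finset.sum_le_sum fun v hv => ?_
        have hv' : k < G.degree v := (Finset.mem_filter.1 hv).2
        exact add_le_add (Finset.sum_le_sum fun x _ => boolExp_stuckAt_le hk hv' x)
          (Finset.sum_le_sum fun T _ => boolExp_stuckIn_le hk0 hv' T)
    _ ≤ ∑ v ∈ B, 3 * n * Real.exp (-(k / 64)) := by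
        refine Finset.sum_le_sum fun v _ => ?_
        have h1 : Real.exp (-(k / 8)) ≤ Real.exp (-(k / 64)) := by
          rw [Real.exp_le_exp]; linarith
        have h2 : n * Real.exp (-(k / 8)) ≤ n * Real.exp (-(k / 64)) := by gcongr
        rw [Finset.sum_const, Finset.card_univ, nsmul_eq_mul]
        linarith
    _ ≤ n * (3 * n * Real.exp (-(k / 64))) := by
        rw [Finset.sum_const, nsmul_eq_mul]
        gcongr
        exact Nat.cast_le.2 (Finset.card_le_univ B)
    _ = _ := by ring

end FirstRound

/-! ### The two rounds together -/

theorem sampledSubgraph_or {V : Type*} {G : SimpleGraph V} (ω₁ ω₂ : G.Dart → Bool) :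
    sampledSubgraph G (fun i => ω₁ i || ω₂ i) = sampledSubgraph G ω₁ ⊔ sampledSubgraph G ω₂ := by
  rw [sampledSubgraph, sampledSubgraph, sampledSubgraph, ← SimpleGraph.fromEdgeSet_union]
  congr 1
  ext e
  simp only [Set.mem_ofPred_eq, Set.mem_union, Bool.or_eq_true]
  constructor
  · rintro ⟨d, rfl, h | h⟩
    exacts [Or.inl ⟨d, rfl, h⟩, Or.inr ⟨d, rfl, h⟩]
  · rintro (⟨d, rfl, h⟩ | ⟨d, rfl, h⟩)
    exacts [⟨d, rfl, Or.inl h⟩, ⟨d, rfl, Or.inr h⟩]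

/-- The second round, on top of a first round all of whose components are large. -/
theorem boolExp_secondRound_le {V : Type*} [Fintype V] {G : SimpleGraph V} [DecidableRel G.Adj]
    [DecidableEq G.Dart] {k : ℝ} (hk : 0 < k) {H : SimpleGraph V}
    (hH : ∀ v, IsGood k (fun v => (G.degree v : ℝ)) H v) :
    boolExp (fun i : G.Dart => k / max k (G.degree i.fst) / (2 - k / max k (G.degree i.fst)))
      (fun ω => ((interComponentEdges G (H ⊔ sampledSubgraph G ω)).ncard : ℝ)) ≤
      144 * (Fintype.card V / k) := by
  classical
  let f : V → ℝ := fun v => if (G.degree v : ℝ) ≤ k then 0 else G.degree v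
  have hf : ∀ v, 0 ≤ f v := fun v => by simp only [f]; split_ifs <;> positivity
  obtain ⟨ρ, hρ, hρf⟩ := exists_ranking f
  have hsum : leaderSum ρ f H ≤ 72 * Fintype.card V := by
    refine leaderSum_le_card hρ (by norm_num) fun v => ?_
    simp only [f]
    split_ifs with h
    · positivity
    · exact (hH v).resolve_left h
  have hmain := boolExp_interComponentEdges_le (G := G) hρ hf hρf
    (b := fun i : G.Dart => k / max k (G.degree i.fst) / (2 - k / max k (G.degree i.fst)))
    (c := 2 / k) (fun i => ?_) (by positivity) (fun i => ?_) H
  · have h1 : 2 / k * leaderSum ρ f H ≤ 2 / k * (72 * Fintype.card V) := by gcongr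
    have h2 : 2 / k * (72 * (Fintype.card V : ℝ)) = 144 * (Fintype.card V / k) := by ring
    exact hmain.trans (h1.trans h2.le)
  · obtain ⟨h1, h2⟩ := div_max_mem hk (G.degree i.fst)
    exact ⟨div_nonneg h1.le (by linarith), (div_le_one (by linarith)).2 (by linarith)⟩
  · obtain ⟨h1, h2⟩ := div_max_mem hk (G.degree i.fst)
    simp only [f]
    split_ifs with h
    · rw [max_eq_left h, div_self hk.ne']
      norm_num
    · push Not at h
      have hD : (0 : ℝ) < G.degree i.fst := hk.trans h
      rw [max_eq_right h.le] at h1 h2 ⊢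
      have h3 : k / G.degree i.fst * (2 / k * G.degree i.fst) = 2 := by field_simp
      rw [div_mul_eq_mul_div, h3, le_div_iff₀ (by linarith), sub_mul,
        div_mul_cancel₀ _ (by linarith)]
      linarith

end

theorem theorem2 :
    ∃ c C : ℝ, 0 < c ∧ 0 < C ∧
      ∀ (V : Type*) [Fintype V] (G : SimpleGraph V) [DecidableRel G.Adj] (k : NNReal),
        0 < k → c * Real.log (Fintype.card V) ≤ k →
          expectedInterComponentEdges G k ≤ C * ((Fintype.card V : ℝ) / k) := by
  classical
  refine ⟨400, 528, by norm_num, by norm_num, ?_⟩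
  intro V _ G _ κ hκ hlog
  rw [expectedInterComponentEdges_eq_boolExp]
  have hk0 : 0 < (κ : ℝ) := by exact_mod_cast hκ
  generalize (κ : ℝ) = k at *
  set n : ℝ := (Fintype.card V : ℝ) with hn
  rw [boolExp_or (a := firstProb G k)
    (b := fun i : G.Dart => k / max k (G.degree i.fst) / (2 - k / max k (G.degree i.fst)))]
  swap
  · intro i
    have := div_max_mem hk0 (G.degree i.fst)
    rw [firstProb]
    generalize k / max k (G.degree i.fst : ℝ) = q at this
    have h2 : 2 - q ≠ 0 := by linarith
    field_simp
    ring
  have hp2 : ∀ i : G.Dart, 0 ≤ k / max k (G.degree i.fst) / (2 - k / max k (G.degree i.fst)) ∧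
      k / max k (G.degree i.fst) / (2 - k / max k (G.degree i.fst)) ≤ 1 := fun i => by
    obtain ⟨h1, h2⟩ := div_max_mem hk0 (G.degree i.fst)
    exact ⟨div_nonneg h1.le (by linarith), (div_le_one (by linarith)).2 (by linarith)⟩
  simp only [sampledSubgraph_or]
  rcases lt_or_ge (Fintype.card V) 2 with hV | hV
  · -- With at most one vertex there is no edge; here `log n = 0` does not bound `k` from below.
    have : Subsingleton V := Fintype.card_le_one_iff_subsingleton.1 (by omega)
    have hempty : ∀ H : SimpleGraph V, interComponentEdges G H = ∅ := fun H =>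
      Set.eq_empty_of_forall_notMem fun e ⟨u, v, _, huv, _⟩ => huv.ne (Subsingleton.elim u v)
    simp only [hempty, Set.ncard_empty, Nat.cast_zero, boolExp_const]
    positivity
  have hn2 : (2 : ℝ) ≤ n := by rw [hn]; exact_mod_cast hV
  have hlog2 : Real.log 2 ≤ Real.log n := Real.log_le_log (by norm_num) hn2
  have hk : 72 ≤ k := by linarith [Real.log_two_gt_d9]
  have hnexp : ∀ m : ℝ, Real.log n ≤ m → n ≤ Real.exp m := fun m hm => by
    rwa [← Real.log_le_iff_le_exp (by linarith)]
  have hδ : n * Real.exp (-(k / 8)) ≤ 1 / 2 := by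
    have h1 := hnexp (k / 16) (by linarith)
    have h2 : Real.exp (-(k / 8)) = Real.exp (-(k / 16)) * Real.exp (-(k / 16)) := by
      rw [← Real.exp_add]; congr 1; ring
    have h3 : Real.exp (k / 16) * Real.exp (-(k / 16)) = 1 := by rw [← Real.exp_add]; simp
    have h4 : Real.exp (-(k / 16)) * 2 ≤ 1 := by
      rw [← h3, mul_comm]; gcongr; linarith
    calc n * Real.exp (-(k / 8)) ≤ Real.exp (k / 16) * Real.exp (-(k / 8)) := by gcongr
      _ = Real.exp (-(k / 16)) := by rw [h2, ← mul_assoc, h3, one_mul]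
      _ ≤ 1 / 2 := by linarith
  have hbad := boolExp_exists_not_good_le (G := G) hk hδ
  calc _ ≤ boolExp (firstProb G k) (fun ω => 144 * (n / k) + n ^ 2 *
        if ∃ v, ¬ IsGood k (fun v => (G.degree v : ℝ)) (sampledSubgraph G ω) v
          then 1 else 0) := by
        refine boolExp_mono (firstProb_mem hk0) fun ω => ?_
        split_ifs with h
        · have h1 := boolExp_mono hp2 (g := fun _ => n ^ 2)
            (f := fun ω₂ => ((interComponentEdges G
              (sampledSubgraph G ω ⊔ sampledSubgraph G ω₂)).ncard : ℝ)) fun ω₂ => by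
            have := ncard_interComponentEdges_le G (sampledSubgraph G ω ⊔ sampledSubgraph G ω₂)
            rw [hn]
            exact_mod_cast this
          rw [boolExp_const] at h1
          have : 0 ≤ 144 * (n / k) := by positivity
          linarith
        · push Not at h
          simpa using boolExp_secondRound_le hk0 h
    _ ≤ 144 * (n / k) + n ^ 2 * (3 * n ^ 2 * Real.exp (-(k / 64))) := by
        rw [boolExp_add, boolExp_const, boolExp_const_mul]
        gcongr
    _ ≤ 528 * (n / k) := by
        have h1 : n ^ 3 ≤ Real.exp (k / 128) := by
          have h := pow_le_pow_left₀ (by linarith) (hnexp (k / 384) (by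
            have : 0 ≤ Real.log n := Real.log_nonneg (by linarith)
            linarith)) 3
          rwa [← Real.exp_nat_mul, show ((3 : ℕ) : ℝ) * (k / 384) = k / 128 by push_cast; ring] at h
        have h2 : k / 128 ≤ Real.exp (k / 128) := by linarith [Real.add_one_le_exp (k / 128)]
        have h3 : Real.exp (k / 128) * Real.exp (k / 128) * Real.exp (-(k / 64)) = 1 := by
          rw [← Real.exp_add, ← Real.exp_add, ← Real.exp_zero]; congr 1; ring
        have h4 : n ^ 3 * (k / 128) * Real.exp (-(k / 64)) ≤ 1 := by
          rw [← h3]; gcongr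
        have h5 : n ^ 2 * (3 * n ^ 2 * Real.exp (-(k / 64))) ≤ 384 * (n / k) := by
          have h6 : 384 * (n / k) * 1 - n ^ 2 * (3 * n ^ 2 * Real.exp (-(k / 64))) =
              384 * (n / k) * (1 - n ^ 3 * (k / 128) * Real.exp (-(k / 64))) := by
            field_simp
            ring
          have h7 : 0 ≤ 384 * (n / k) * (1 - n ^ 3 * (k / 128) * Real.exp (-(k / 64))) :=
            mul_nonneg (by positivity) (by linarith)
          linarith
        linarith
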